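/- Let $\alpha,\beta>-1$, $\xi\in\mathbb{R}$ with $|\xi|\ge 1$, and $M\ge 0$. For real polynomials $p$ put $$c_0(p)=\int_{-1}^{1}p(x)(1-x)^{\alpha}(1+x)^{\beta}\,dx,\qquad c_1(p)=\int_{-1}^{1}p(x)\frac{(1-x)^{\alpha+1}(1+x)^{\beta+1}}{|x-\xi|}\,dx+M\,p(\xi).$$ Then $(c_0,c_1)$ is a coherent pair: the sequences $(P_n)_{n\ge0}$ and $(T_n)_{n\ge0}$ of monic orthogonal polynomials with respect to $c_0$ and $c_1$ exist, and there are real numbers $\sigma_n\neq0$ $(n\ge1)$ with $$T_n=\frac{P_{n+1}'}{n+1}-\sigma_n\frac{P_n'}{n}\qquad(n\ge1).$$ Put $k^{(0)}_n=c_0(P_n^2)$ and $k^{(1)}_n=c_1(T_n^2)$, and define polynomials $A_n$ by $A_0(\lambda)=1$, $A_1(\lambda)=\lambda-k^{(0)}_1/k^{(1)}_0$ and, for $n\ge2$, $$A_n(\lambda)=\left(\lambda-\frac{k^{(0)}_n}{n^2k^{(1)}_{n-1}}-\frac{\sigma_{n-1}^2}{(n-1)^2}\frac{k^{(0)}_{n-1}}{k^{(1)}_{n-1}}\right)A_{n-1}(\lambda)-\frac{\sigma_{n-1}^2\,(k^{(0)}_{n-1})^2}{(n-1)^4k^{(1)}_{n-1}k^{(1)}_{n-2}}A_{n-2}(\lambda).$$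 Then, for every $n\ge1$, $A_n$ has a smallest real zero $\mu_{1,n}$, and $$\lim_{n\to\infty}\mu_{1,n}=0.$$ -/

import Mathlib

open MeasureTheory Polynomial Filter Topology

noncomputable section

namespace CoherentPair

/-- The linear functional `p ↦ ∫ p dμ` on real polynomials given by a measure `μ` on `ℝ`. -/
def functional (μ : Measure ℝ) (p : ℝ[X]) : ℝ :=
  ∫ x, p.eval x ∂μ

/-- The Jacobi measure `(1-x)^α (1+x)^β dx` on `]-1,1[`. -/
def jacobiMeasure (α β : ℝ) : Measure ℝ :=
  (volume.restrict (Set.Ioo (-1 : ℝ) 1)).withDensity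
    fun x => ENNReal.ofReal ((1 - x) ^ α * (1 + x) ^ β)

/-- The measure `|x-ξ|⁻¹ (1-x)^(α+1) (1+x)^(β+1) dx + M δ(ξ)`, the first part being carried
by `]-1,1[`. -/
def companionMeasure (α β ξ M : ℝ) : Measure ℝ :=
  (volume.restrict (Set.Ioo (-1 : ℝ) 1)).withDensity
    (fun x => ENNReal.ofReal (1 / |x - ξ| * ((1 - x) ^ (α + 1) * (1 + x) ^ (β + 1))))
  + ENNReal.ofReal M • Measure.dirac ξ

/-- `P` is the sequence of monic orthogonal polynomials of the functional `c`. -/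
structure IsMonicOPS (c : ℝ[X] → ℝ) (P : ℕ → ℝ[X]) : Prop where
  monic : ∀ n, (P n).Monic
  natDegree_eq : ∀ n, (P n).natDegree = n
  orthogonal : ∀ m n, m ≠ n → c (P m * P n) = 0
  sq_ne_zero : ∀ n, c (P n ^ 2) ≠ 0

/-- `(c₀, c₁)` is a coherent pair, with monic orthogonal polynomials `P` (for `c₀`) and `T`
(for `c₁`) and with coherence coefficients `σ n`, `n ≥ 1`. The value `σ 0` plays no role. -/
structure IsCoherent (c₀ c₁ : ℝ[X] → ℝ) (P T : ℕ → ℝ[X]) (σ : ℕ → ℝ) : Prop where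
  ops_left : IsMonicOPS c₀ P
  ops_right : IsMonicOPS c₁ T
  coeff_ne_zero : ∀ n, 1 ≤ n → σ n ≠ 0
  relation : ∀ n : ℕ, 1 ≤ n →
    T n = C (1 / ((n : ℝ) + 1)) * derivative (P (n + 1))
      - C (σ n / (n : ℝ)) * derivative (P n)

/-- The polynomials `A_n` given by `A_0 = 1`, `A_1 = λ - k⁰_1 / k¹_0` and, for `n ≥ 2`,
`A_n = (λ - k⁰_n / (n² k¹_{n-1}) - σ_{n-1}² k⁰_{n-1} / ((n-1)² k¹_{n-1})) A_{n-1}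
  - σ_{n-1}² (k⁰_{n-1})² / ((n-1)⁴ k¹_{n-1} k¹_{n-2}) A_{n-2}`,
where `k⁰_n = c₀ (P_n²)` and `k¹_n = c₁ (T_n²)`. -/
def recPoly (c₀ c₁ : ℝ[X] → ℝ) (P T : ℕ → ℝ[X]) (σ : ℕ → ℝ) : ℕ → ℝ[X]
  | 0 => 1
  | 1 => X - C (c₀ (P 1 ^ 2) / c₁ (T 0 ^ 2))
  | n + 2 =>
      (X - C (c₀ (P (n + 2) ^ 2) / (((n : ℝ) + 2) ^ 2 * c₁ (T (n + 1) ^ 2)))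
        - C (σ (n + 1) ^ 2 / ((n : ℝ) + 1) ^ 2 * (c₀ (P (n + 1) ^ 2) / c₁ (T (n + 1) ^ 2))))
        * recPoly c₀ c₁ P T σ (n + 1)
      - C (σ (n + 1) ^ 2 * c₀ (P (n + 1) ^ 2) ^ 2
          / (((n : ℝ) + 1) ^ 4 * c₁ (T (n + 1) ^ 2) * c₁ (T n ^ 2)))
        * recPoly c₀ c₁ P T σ n

end CoherentPair

end

/-! Let `u` be the Jacobi functional with parameters `α + 1`, `β + 1`. Integration by parts makes
the derivatives of the `P n` orthogonal for `u`, with `u (P_n'²) = n (n + α + β + 1) k⁰_n`. On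
`]-1,1[` the sign of `x - ξ` is constant, so `u` is `±(x - ξ)` times `c₁`; hence `T n` has only two
terms in the basis of the derivatives, which is coherence (`exists_isCoherent`). The recurrence for
`A_n` has diagonal entries `p (n + 1) + q n` and off-diagonal products `q n * p n`, the pattern of a
product of a bidiagonal matrix and its transpose. So the smallest zero is positive and at most the
last diagonal entry (`exists_isLeast_isRoot_of_recurrence`). By coherence, `u (T_{n+1}²)` is the sum
defining that entry times `c₁ (T_{n+1}²)`, with its two terms weighted by factors at least `(α + β +
2) (n + 1)`. Since `u ≤ (1 + |ξ|) c₁` on squares, the entry is `O(1/n)`. -/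

namespace CoherentPair

/-! ### Monic orthogonal polynomials of a positive functional. -/

/-- The monic polynomials obtained from the monomials by Gram-Schmidt orthogonalization. -/
noncomputable def monicGramSchmidt (φ : ℝ[X] →ₗ[ℝ] ℝ) : ℕ → ℝ[X]
  | n => X ^ n - ∑ k : Fin n,
      C (φ (X ^ n * monicGramSchmidt φ k) / φ (monicGramSchmidt φ k ^ 2)) * monicGramSchmidt φ k
decreasing_by all_goals exact k.2

theorem map_C_mul (φ : ℝ[X] →ₗ[ℝ] ℝ) (a : ℝ) (p : ℝ[X]) : φ (C a * p) = a * φ p := by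
  rw [← smul_eq_C_mul, map_smul, smul_eq_mul]

theorem monicGramSchmidt_spec {φ : ℝ[X] →ₗ[ℝ] ℝ} (hφ : ∀ p, p ≠ 0 → 0 < φ (p ^ 2)) (n : ℕ) :
    (monicGramSchmidt φ n).Monic ∧ (monicGramSchmidt φ n).natDegree = n ∧
      ∀ k < n, φ (monicGramSchmidt φ n * monicGramSchmidt φ k) = 0 := by
  induction n using Nat.strong_induction_on with
  | _ n ih =>
    have hdeg : (∑ k : Fin n, C (φ (X ^ n * monicGramSchmidt φ k) / φ (monicGramSchmidt φ k ^ 2))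
        * monicGramSchmidt φ k).degree < n := by
      rw [← mem_degreeLT]
      refine Submodule.sum_mem _ fun k _ => ?_
      rw [← smul_eq_C_mul]
      refine Submodule.smul_mem _ _ (mem_degreeLT.2 ?_)
      rw [degree_eq_natDegree (ih k k.2).1.ne_zero, (ih k k.2).2.1]
      exact_mod_cast k.2
    have hmon : (monicGramSchmidt φ n).Monic := by
      rw [monicGramSchmidt]
      exact monic_X_pow_sub hdeg
    refine ⟨hmon, ?_, ?_⟩
    · apply natDegree_eq_of_degree_eq_some
      rw [monicGramSchmidt, degree_sub_eq_left_of_degree_lt (by rwa [degree_X_pow]), degree_X_pow]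
    · intro k hk
      have hpos := hφ _ (ih k hk).1.ne_zero
      rw [monicGramSchmidt, sub_mul, map_sub, Finset.sum_mul, map_sum,
        Finset.sum_eq_single (⟨k, hk⟩ : Fin n)]
      · simp only [mul_assoc, map_C_mul, ← pow_two]
        field_simp
        simp
      · intro j _ hj
        rw [mul_assoc, map_C_mul]
        rcases lt_trichotomy (j : ℕ) k with h | h | h
        · rw [mul_comm (monicGramSchmidt φ j), (ih k hk).2.2 j h, mul_zero]
        · exact absurd (Fin.ext h) hj
        · rw [(ih j j.2).2.2 k h, mul_zero]
      · simp

theorem exists_isMonicOPS {φ : ℝ[X] →ₗ[ℝ] ℝ} (hφ : ∀ p, p ≠ 0 → 0 < φ (p ^ 2)) :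
    ∃ P, IsMonicOPS φ P := by
  refine ⟨monicGramSchmidt φ, fun n => (monicGramSchmidt_spec hφ n).1,
    fun n => (monicGramSchmidt_spec hφ n).2.1, fun m n hmn => ?_,
    fun n => (hφ _ (monicGramSchmidt_spec hφ n).1.ne_zero).ne'⟩
  rcases hmn.lt_or_gt with h | h
  · rw [mul_comm]
    exact (monicGramSchmidt_spec hφ n).2.2 m h
  · exact (monicGramSchmidt_spec hφ m).2.2 n h

theorem IsMonicOPS.coeff_self {c : ℝ[X] → ℝ} {P : ℕ → ℝ[X]} (hP : IsMonicOPS c P) (n : ℕ) :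
    (P n).coeff n = 1 := by
  have := (hP.monic n).coeff_natDegree
  rwa [hP.natDegree_eq] at this

theorem IsMonicOPS.coeff_eq_zero {c : ℝ[X] → ℝ} {P : ℕ → ℝ[X]} (hP : IsMonicOPS c P) {n k : ℕ}
    (h : n < k) : (P n).coeff k = 0 :=
  coeff_eq_zero_of_natDegree_lt (by rwa [hP.natDegree_eq])

theorem IsMonicOPS.map_mul_eq_zero {φ : ℝ[X] →ₗ[ℝ] ℝ} {P : ℕ → ℝ[X]} (hP : IsMonicOPS φ P)
    {n : ℕ} (r : ℝ[X]) (hr : ∀ k, n ≤ k → r.coeff k = 0) : φ (P n * r) = 0 := by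
  suffices H : ∀ d ≤ n, ∀ r : ℝ[X], (∀ k, d ≤ k → r.coeff k = 0) → φ (P n * r) = 0 from
    H n le_rfl r hr
  intro d
  induction d with
  | zero =>
    intro _ r hr
    have : r = 0 := by ext k; simpa using hr k (Nat.zero_le k)
    simp [this]
  | succ d ih =>
    intro hd r hr
    have h1 : φ (P n * (r - C (r.coeff d) * P d)) = 0 := by
      refine ih (by lia) _ fun k hk => ?_
      rw [coeff_sub, coeff_C_mul]
      rcases hk.eq_or_lt with rfl | hk
      · rw [hP.coeff_self]; ring
      · rw [hr k hk, hP.coeff_eq_zero hk]; ring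
    have h2 : φ (P n * (C (r.coeff d) * P d)) = 0 := by
      rw [mul_left_comm, map_C_mul, hP.orthogonal n d (by lia), mul_zero]
    rw [mul_sub, map_sub, h2, sub_zero] at h1
    exact h1

theorem IsMonicOPS.map_mul_eq {φ : ℝ[X] →ₗ[ℝ] ℝ} {P : ℕ → ℝ[X]} (hP : IsMonicOPS φ P)
    {n : ℕ} (r : ℝ[X]) (hr : ∀ k, n < k → r.coeff k = 0) :
    φ (P n * r) = r.coeff n * φ (P n ^ 2) := by
  have h1 : φ (P n * (r - C (r.coeff n) * P n)) = 0 := by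
    refine hP.map_mul_eq_zero _ fun k hk => ?_
    rw [coeff_sub, coeff_C_mul]
    rcases hk.eq_or_lt with rfl | hk
    · rw [hP.coeff_self]; ring
    · rw [hr k hk, hP.coeff_eq_zero hk]; ring
  rw [mul_sub, map_sub, mul_left_comm, map_C_mul, ← pow_two] at h1
  linarith

/-! ### Smallest zeros of the three-term recurrence. -/

theorem exists_isLeast_zero {f : ℝ → ℝ} (hf : Continuous f) (h0 : ∀ x ≤ 0, 0 < f x) {b : ℝ}
    (hb : f b ≤ 0) :
    ∃ μ, IsLeast {x | f x = 0} μ ∧ 0 < μ ∧ μ ≤ b ∧ ∀ x < μ, 0 < f x := by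
  have hb0 : 0 < b := by
    by_contra! h
    exact (h0 b h).not_ge hb
  obtain ⟨z, hz, hfz⟩ : ∃ z ∈ Set.Icc 0 b, f z = 0 := by
    have := intermediate_value_Icc' hb0.le hf.continuousOn
    exact this ⟨hb, (h0 0 le_rfl).le⟩
  have hlow : ∀ x ∈ {x | f x = 0}, 0 < x := by
    intro x hx
    by_contra! h
    exact (h0 x h).ne' hx
  have hleast : IsLeast {x | f x = 0} (sInf {x | f x = 0}) :=
    (isClosed_singleton.preimage hf).isLeast_csInf ⟨z, hfz⟩ ⟨0, fun x hx => (hlow x hx).le⟩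
  refine ⟨_, hleast, hlow _ hleast.1, (hleast.2 hfz).trans hz.2, fun x hx => ?_⟩
  by_contra! h
  have hx0 : 0 < x := by
    by_contra! h'
    exact (h0 x h').not_ge h
  obtain ⟨y, hy, hfy⟩ : ∃ y ∈ Set.Icc 0 x, f y = 0 := by
    have := intermediate_value_Icc' hx0.le hf.continuousOn
    exact this ⟨h, (h0 0 le_rfl).le⟩
  exact ((hleast.2 hfy).trans hy.2).not_gt hx

/-- The smallest zeros strictly decrease with the degree, which is proved directly from signs,
without the spectral theory of Jacobi matrices. -/
theorem exists_isLeast_isRoot_of_recurrence {A : ℕ → ℝ[X]} {p q : ℕ → ℝ} (hp : ∀ n, 0 < p n)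
    (hq : ∀ n, 0 < q n) (hA0 : A 0 = 1) (hA1 : A 1 = X - C (p 0))
    (hA : ∀ n, A (n + 2) = (X - C (p (n + 1)) - C (q n)) * A (n + 1) - C (q n * p n) * A n) :
    ∃ μ : ℕ → ℝ, (∀ n, 1 ≤ n → IsLeast {x | (A n).IsRoot x} (μ n)) ∧
      ∀ n, 0 < μ (n + 2) ∧ μ (n + 2) ≤ p (n + 1) + q n := by
  -- The sign normalises the polynomials to be positive to the left of all their zeros.
  set D : ℕ → ℝ → ℝ := fun n x => (-1) ^ n * (A n).eval x with hD
  have hD0 : ∀ x, D 0 x = 1 := fun x => by simp [hD, hA0]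
  have hD1 : ∀ x, D 1 x = p 0 - x := fun x => by simp [hD, hA1]
  have hD2 : ∀ n x, D (n + 2) x = (p (n + 1) + q n - x) * D (n + 1) x - q n * p n * D n x := by
    intro n x
    simp only [hD, hA, eval_sub, eval_mul, eval_X, eval_C]
    ring
  have hcont : ∀ n, Continuous (D n) := fun n => continuous_const.mul (A n).continuous
  have hroot : ∀ n, {x | (A n).IsRoot x} = {x | D n x = 0} := by
    intro n
    ext x
    simp [hD, IsRoot.def]
  -- The invariant propagates because `D (n + 2) - p (n + 1) * D (n + 1) = q n * (D (n + 1) - p n *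
  -- D n) - x * D (n + 1)`.
  have hpos : ∀ n, ∀ x ≤ 0, 0 < D n x ∧ p n * D n x ≤ D (n + 1) x := by
    intro n x hx
    induction n with
    | zero => rw [zero_add, hD0, hD1]; constructor <;> linarith
    | succ n ih =>
      have h1 : 0 < D (n + 1) x := (mul_pos (hp n) ih.1).trans_le ih.2
      refine ⟨h1, ?_⟩
      rw [hD2]
      nlinarith [mul_nonneg (hq n).le (sub_nonneg.2 ih.2), mul_nonneg (neg_nonneg.2 hx) h1.le]
  have key : ∀ n, ∃ μ, IsLeast {x | D (n + 1) x = 0} μ ∧ 0 < D n μ ∧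
      (∀ x < μ, 0 < D n x) ∧ ∀ x < μ, 0 < D (n + 1) x := by
    intro n
    induction n with
    | zero =>
      refine ⟨p 0, ⟨by simp [hD1], fun x hx => ?_⟩, by simp [hD0], by simp [hD0], fun x hx => ?_⟩
      · have : D 1 x = 0 := hx
        rw [hD1] at this
        linarith
      · rw [zero_add, hD1]; linarith
    | succ n ih =>
      obtain ⟨μ, hμ, h1, h2, h3⟩ := ih
      -- At the least zero of `D (n + 1)` only the term `-q n * p n * D n` survives, which forces a
      -- zero of `D (n + 2)` further left.
      have hneg : D (n + 2) μ < 0 := by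
        have : D (n + 1) μ = 0 := hμ.1
        rw [hD2, this]
        have := mul_pos (mul_pos (hq n) (hp n)) h1
        linarith
      obtain ⟨ν, hν, -, hνμ, hν'⟩ :=
        exists_isLeast_zero (hcont (n + 2)) (fun x hx => (hpos _ x hx).1) hneg.le
      have hlt : ν < μ := by
        refine lt_of_le_of_ne hνμ fun h => ?_
        have : D (n + 2) ν = 0 := hν.1
        rw [h] at this
        linarith
      exact ⟨ν, hν, h3 ν hlt, fun x hx => h3 x (hx.trans hlt), hν'⟩
  choose μ hμ h1 h2 h3 using key
  -- `μ m` belongs to degree `m + 1`; the value at `n = 0` is junk.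
  refine ⟨fun n => μ (n - 1), fun n hn => ?_, fun n => ⟨?_, ?_⟩⟩
  · obtain ⟨m, rfl⟩ := Nat.exists_eq_add_of_le' hn
    rw [hroot]
    exact hμ m
  · by_contra! h
    exact (hpos (n + 2) _ h).1.ne' (hμ (n + 1)).1
  · by_contra! h
    have h4 := h3 (n + 1) _ h
    rw [hD2, sub_self, zero_mul, zero_sub, neg_pos] at h4
    -- At `x = p (n + 1) + q n` the recurrence gives `D (n + 2) x = -q n * p n * D n x`.
    -- Monotonicity of the least zeros puts `x` to the left of the zeros of `D n` as well, so this
    -- is negative, although `x` was assumed to lie left of the zeros of `D (n + 2)`.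
    have hlt : p (n + 1) + q n < μ n := by
      by_contra! h5
      have h6 := h2 (n + 1) _ (h5.trans_lt h)
      exact h6.ne' (hμ n).1
    exact h4.not_gt (mul_pos (mul_pos (hq n) (hp n)) (h2 n _ hlt))

/-! ### Derivatives of Jacobi polynomials and coherence. -/

/-- The Jacobi differential operator `q ↦ (x² - 1) q'' + ((α + 1) (1 + x) - (β + 1) (1 - x)) q'`. -/
noncomputable def jacobiOperator (α β : ℝ) (q : ℝ[X]) : ℝ[X] :=
  (C (α + 1) * (1 + X) - C (β + 1) * (1 - X)) * derivative q
    - (1 - X ^ 2) * derivative (derivative q)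

/-- Used to see that the operator does not raise the degree and to read off its eigenvalue `n (n + α
+ β + 1)` on leading coefficients. -/
theorem coeff_jacobiOperator (α β : ℝ) (q : ℝ[X]) (n : ℕ) :
    (jacobiOperator α β q).coeff n = n * (n + α + β + 1) * q.coeff n
      + (α - β) * (n + 1) * q.coeff (n + 1) - (n + 2) * (n + 1) * q.coeff (n + 2) := by
  have h : jacobiOperator α β q = C (α + β + 2) * (X * derivative q) + C (α - β) * derivative q
      - derivative (derivative q) + X * (X * derivative (derivative q)) := by
    simp only [jacobiOperator, C_add, C_sub, C_1, map_ofNat]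
    ring
  rw [h]
  rcases n with _ | _ | n <;>
    simp only [coeff_add, coeff_sub, coeff_C_mul, coeff_X_mul, coeff_X_mul_zero,
      coeff_derivative] <;> push_cast <;> ring

variable {α β ξ s K : ℝ} {c₀ u c₁ : ℝ[X] →ₗ[ℝ] ℝ} {P T : ℕ → ℝ[X]} {σ : ℕ → ℝ}

/-- This is `hd`, integration by parts in abstract form, applied to `p * derivative q`. -/
theorem map_derivative_mul_derivative (hu : ∀ p, u p = c₀ ((1 - X ^ 2) * p))
    (hd : ∀ r, u (derivative r) = c₀ ((C (α + 1) * (1 + X) - C (β + 1) * (1 - X)) * r))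
    (p q : ℝ[X]) : u (derivative p * derivative q) = c₀ (p * jacobiOperator α β q) := by
  have h := hd (p * derivative q)
  rw [derivative_mul, map_add, hu (p * _)] at h
  rw [eq_sub_of_add_eq h, ← map_sub]
  congr 1
  rw [jacobiOperator]
  ring

theorem map_derivative_mul_derivative_of_ne (hP : IsMonicOPS c₀ P)
    (hu : ∀ p, u p = c₀ ((1 - X ^ 2) * p))
    (hd : ∀ r, u (derivative r) = c₀ ((C (α + 1) * (1 + X) - C (β + 1) * (1 - X)) * r))
    {m n : ℕ} (hmn : m ≠ n) : u (derivative (P m) * derivative (P n)) = 0 := by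
  wlog h : n < m generalizing m n
  · rw [mul_comm]
    exact this hmn.symm (by lia)
  rw [map_derivative_mul_derivative hu hd]
  refine hP.map_mul_eq_zero _ fun k hk => ?_
  rw [coeff_jacobiOperator, hP.coeff_eq_zero (by lia), hP.coeff_eq_zero (by lia),
    hP.coeff_eq_zero (by lia)]
  ring

theorem map_derivative_sq (hP : IsMonicOPS c₀ P) (hu : ∀ p, u p = c₀ ((1 - X ^ 2) * p))
    (hd : ∀ r, u (derivative r) = c₀ ((C (α + 1) * (1 + X) - C (β + 1) * (1 - X)) * r)) (n : ℕ) :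
    u (derivative (P n) ^ 2) = n * (n + α + β + 1) * c₀ (P n ^ 2) := by
  rw [pow_two, map_derivative_mul_derivative hu hd, hP.map_mul_eq]
  · rw [coeff_jacobiOperator, hP.coeff_self, hP.coeff_eq_zero (by lia),
      hP.coeff_eq_zero (by lia)]
    ring
  · intro k hk
    rw [coeff_jacobiOperator, hP.coeff_eq_zero hk, hP.coeff_eq_zero (by lia),
      hP.coeff_eq_zero (by lia)]
    ring

theorem isMonicOPS_derivative (hP : IsMonicOPS c₀ P) (hu : ∀ p, u p = c₀ ((1 - X ^ 2) * p))
    (hd : ∀ r, u (derivative r) = c₀ ((C (α + 1) * (1 + X) - C (β + 1) * (1 - X)) * r))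
    (hupos : ∀ p, p ≠ 0 → 0 < u (p ^ 2)) :
    IsMonicOPS u fun n : ℕ => C (1 / ((n : ℝ) + 1)) * derivative (P (n + 1)) := by
  have hcoeff : ∀ n : ℕ, (C (1 / ((n : ℝ) + 1)) * derivative (P (n + 1))).coeff n = 1 := by
    intro n
    have : (n : ℝ) + 1 ≠ 0 := by positivity
    rw [coeff_C_mul, coeff_derivative, hP.coeff_self]
    field_simp
  have hdeg : ∀ n : ℕ, (C (1 / ((n : ℝ) + 1)) * derivative (P (n + 1))).natDegree ≤ n := by
    intro n
    refine natDegree_le_iff_coeff_eq_zero.2 fun k hk => ?_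
    rw [coeff_C_mul, coeff_derivative, hP.coeff_eq_zero (by lia)]
    ring
  have hmon : ∀ n : ℕ, (C (1 / ((n : ℝ) + 1)) * derivative (P (n + 1))).Monic := fun n =>
    monic_of_natDegree_le_of_coeff_eq_one n (hdeg n) (hcoeff n)
  refine ⟨hmon, fun n => ?_, fun m n hmn => ?_, fun n => (hupos _ (hmon n).ne_zero).ne'⟩
  · exact le_antisymm (hdeg n) (le_natDegree_of_ne_zero (by rw [hcoeff]; exact one_ne_zero))
  · rw [mul_mul_mul_comm, ← C_mul, map_C_mul,
      map_derivative_mul_derivative_of_ne hP hu hd (by lia), mul_zero]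

/-- The remainder `R` of the two-term expansion of `T (m + 1)` has degree at most `m`, and `u (R ^
2)` vanishes, so `R = 0` by positivity of `u`. -/
theorem exists_isCoherent (hu : ∀ p, u p = c₀ ((1 - X ^ 2) * p))
    (hd : ∀ r, u (derivative r) = c₀ ((C (α + 1) * (1 + X) - C (β + 1) * (1 - X)) * r))
    (hs : s ≠ 0) (hu₁ : ∀ p, u p = s * c₁ ((X - C ξ) * p))
    (hc₀ : ∀ p, p ≠ 0 → 0 < c₀ (p ^ 2)) (hupos : ∀ p, p ≠ 0 → 0 < u (p ^ 2))
    (hc₁ : ∀ p, p ≠ 0 → 0 < c₁ (p ^ 2)) : ∃ P T σ, IsCoherent c₀ c₁ P T σ := by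
  obtain ⟨P, hP⟩ := exists_isMonicOPS hc₀
  obtain ⟨T, hT⟩ := exists_isMonicOPS hc₁
  obtain ⟨Q, hQdef⟩ : ∃ Q : ℕ → ℝ[X],
    Q = fun n : ℕ => C (1 / ((n : ℝ) + 1)) * derivative (P (n + 1)) := ⟨_, rfl⟩
  have hQ : IsMonicOPS u Q := hQdef ▸ isMonicOPS_derivative hP hu hd hupos
  refine ⟨P, T, fun n => -(s * c₁ (T n ^ 2) / u (Q (n - 1) ^ 2)), hP, hT, fun n hn => ?_,
    fun n hn => ?_⟩
  · exact neg_ne_zero.2 (div_ne_zero (mul_ne_zero hs (hT.sq_ne_zero n)) (hQ.sq_ne_zero _))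
  · obtain ⟨m, rfl⟩ := Nat.exists_eq_add_of_le' hn
    simp only [Nat.add_sub_cancel]
    -- The Fourier coefficient `u (T (m + 1) * Q m) / u (Q m ^ 2)`: since `u = s (x - ξ) c₁`, only
    -- the leading term of `(X - C ξ) * Q m` contributes.
    set t : ℝ := s * c₁ (T (m + 1) ^ 2) / u (Q m ^ 2) with ht
    have hrel : C (-t / ((m + 1 : ℕ) : ℝ)) * derivative (P (m + 1)) = - (C t * Q m) := by
      simp only [hQdef, ← mul_assoc, ← C_mul, ← neg_mul, ← C_neg]
      push_cast
      congr 2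
      ring
    rw [hrel]
    rw [← congrFun hQdef (m + 1)]
    set R := T (m + 1) - Q (m + 1) - C t * Q m with hR
    have hRcoeff : ∀ k, m < k → R.coeff k = 0 := by
      intro k hk
      rw [hR, coeff_sub, coeff_sub, coeff_C_mul, hQ.coeff_eq_zero hk]
      rcases (Nat.succ_le_of_lt hk).eq_or_lt with rfl | hk
      · rw [hT.coeff_self, hQ.coeff_self]; ring
      · rw [hT.coeff_eq_zero hk, hQ.coeff_eq_zero hk]; ring
    have h1 : u (T (m + 1) * R) = s * (R.coeff m * c₁ (T (m + 1) ^ 2)) := by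
      have hc : ((X - C ξ) * R).coeff (m + 1) = R.coeff m := by
        rw [sub_mul, coeff_sub, coeff_X_mul, coeff_C_mul, hRcoeff _ (Nat.lt_succ_self m)]
        ring
      rw [hu₁, mul_left_comm, hT.map_mul_eq, hc]
      rintro (_ | k) hk
      · lia
      · rw [sub_mul, coeff_sub, coeff_X_mul, coeff_C_mul, hRcoeff _ (by lia), hRcoeff _ (by lia)]
        ring
    have h2 : u (Q (m + 1) * R) = 0 := hQ.map_mul_eq_zero _ fun k hk => hRcoeff k (by lia)
    have h3 : u (Q m * R) = R.coeff m * u (Q m ^ 2) := hQ.map_mul_eq _ hRcoeff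
    have h4 : u (R ^ 2) = 0 := by
      have : R ^ 2 = T (m + 1) * R - Q (m + 1) * R - C t * (Q m * R) := by
        rw [pow_two]
        nth_rw 1 [hR]
        ring
      rw [this, map_sub, map_sub, map_C_mul, h1, h2, h3, ht]
      have := hQ.sq_ne_zero m
      field_simp
      ring
    have h5 : R = 0 := by
      by_contra h
      exact (hupos R h).ne' h4
    rw [hR] at h5
    linear_combination h5

/-! ### Decay of the diagonal entries. -/

theorem exists_tendsto_isLeast_isRoot_recPoly (hα : -1 < α) (hβ : -1 < β)
    (hu : ∀ p, u p = c₀ ((1 - X ^ 2) * p))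
    (hd : ∀ r, u (derivative r) = c₀ ((C (α + 1) * (1 + X) - C (β + 1) * (1 - X)) * r))
    (hu₁ : ∀ p, u (p ^ 2) ≤ K * c₁ (p ^ 2))
    (hc₀ : ∀ p, p ≠ 0 → 0 < c₀ (p ^ 2))
    (hc₁ : ∀ p, p ≠ 0 → 0 < c₁ (p ^ 2)) (h : IsCoherent c₀ c₁ P T σ) :
    ∃ μ : ℕ → ℝ, (∀ n, 1 ≤ n → IsLeast {x | (recPoly c₀ c₁ P T σ n).IsRoot x} (μ n)) ∧
      Tendsto μ atTop (𝓝 0) := by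
  have hP := h.ops_left
  have k₀ : ∀ n, 0 < c₀ (P n ^ 2) := fun n => hc₀ _ (hP.monic n).ne_zero
  have k₁ : ∀ n, 0 < c₁ (T n ^ 2) := fun n => hc₁ _ (h.ops_right.monic n).ne_zero
  set p : ℕ → ℝ := fun n => c₀ (P (n + 1) ^ 2) / (((n : ℝ) + 1) ^ 2 * c₁ (T n ^ 2)) with hp
  set q : ℕ → ℝ := fun n =>
    σ (n + 1) ^ 2 / ((n : ℝ) + 1) ^ 2 * (c₀ (P (n + 1) ^ 2) / c₁ (T (n + 1) ^ 2)) with hq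
  have hp0 : ∀ n, 0 < p n := fun n =>
    div_pos (k₀ _) (mul_pos (by positivity) (k₁ _))
  have hq0 : ∀ n, 0 < q n := fun n =>
    mul_pos (div_pos (pow_two_pos_of_ne_zero (h.coeff_ne_zero _ (by lia))) (by positivity))
      (div_pos (k₀ _) (k₁ _))
  obtain ⟨μ, hμ, hb⟩ := exists_isLeast_isRoot_of_recurrence (A := recPoly c₀ c₁ P T σ) hp0 hq0
    (by rw [recPoly]) (by simp [recPoly, hp]) (fun n => by
      rw [recPoly]
      have e1 : p (n + 1) = c₀ (P (n + 2) ^ 2) / (((n : ℝ) + 2) ^ 2 * c₁ (T (n + 1) ^ 2)) := by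
        simp only [hp]
        push_cast
        congr 3
        ring
      have e2 : q n * p n = σ (n + 1) ^ 2 * c₀ (P (n + 1) ^ 2) ^ 2
          / (((n : ℝ) + 1) ^ 4 * c₁ (T (n + 1) ^ 2) * c₁ (T n ^ 2)) := by
        simp only [hp, hq]
        have := (k₁ n).ne'
        have := (k₁ (n + 1)).ne'
        field_simp
      rw [e1, e2])
  have hbound : ∀ n : ℕ, p (n + 1) + q n ≤ K / (α + β + 2) * (1 / ((n : ℝ) + 1)) := by
    intro n
    have hab : 0 < α + β + 2 := by linarith
    have hn : (0 : ℝ) ≤ n := n.cast_nonneg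
    -- Pythagoras: the two derivatives in the coherence relation are orthogonal for `u`.
    have hT : u (T (n + 1) ^ 2) = 1 / ((n : ℝ) + 2) ^ 2 * u (derivative (P (n + 2)) ^ 2)
        + (σ (n + 1) / ((n : ℝ) + 1)) ^ 2 * u (derivative (P (n + 1)) ^ 2) := by
      have e : T (n + 1) ^ 2 = C (1 / ((n : ℝ) + 2) ^ 2) * derivative (P (n + 2)) ^ 2
          + C ((σ (n + 1) / ((n : ℝ) + 1)) ^ 2) * derivative (P (n + 1)) ^ 2
          - C (2 * (1 / ((n : ℝ) + 2)) * (σ (n + 1) / ((n : ℝ) + 1)))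
            * (derivative (P (n + 2)) * derivative (P (n + 1))) := by
        rw [h.relation (n + 1) (by lia)]
        have : ((n + 1 : ℕ) : ℝ) + 1 = n + 2 := by push_cast; ring
        rw [this, ← one_div_pow]
        simp only [C_mul, C_pow, map_ofNat]
        push_cast
        ring
      rw [e, map_sub, map_add, map_C_mul, map_C_mul, map_C_mul,
        map_derivative_mul_derivative_of_ne hP hu hd (by lia)]
      ring
    rw [map_derivative_sq hP hu hd, map_derivative_sq hP hu hd] at hT
    have hle := hu₁ (T (n + 1))
    rw [hT] at hle
    have hA := k₀ (n + 2)
    have hB := k₀ (n + 1)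
    have hC := k₁ (n + 1)
    have e : p (n + 1) + q n = (1 / ((n : ℝ) + 2) ^ 2 * c₀ (P (n + 2) ^ 2)
        + (σ (n + 1) / ((n : ℝ) + 1)) ^ 2 * c₀ (P (n + 1) ^ 2)) / c₁ (T (n + 1) ^ 2) := by
      simp only [hp, hq]
      push_cast
      field_simp
      ring
    rw [e, div_le_iff₀ hC]
    push_cast at hle
    set a := c₀ (P (n + 2) ^ 2)
    set b := c₀ (P (n + 1) ^ 2)
    set d := c₁ (T (n + 1) ^ 2)
    have hx : 0 ≤ 1 / ((n : ℝ) + 2) ^ 2 * a := by positivity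
    have hy : 0 ≤ (σ (n + 1) / ((n : ℝ) + 1)) ^ 2 * b := by positivity
    set x := 1 / ((n : ℝ) + 2) ^ 2 * a with hxdef
    set y := (σ (n + 1) / ((n : ℝ) + 1)) ^ 2 * b with hydef
    -- Both eigenvalues are bounded below by one common multiple of `n + 1`, positive because `α + β
    -- + 2 > 0`.
    have hl1 : (α + β + 2) * (n + 1) ≤ ((n : ℝ) + 2) * (n + 2 + α + β + 1) := by nlinarith
    have hl2 : (α + β + 2) * (n + 1) ≤ ((n : ℝ) + 1) * (n + 1 + α + β + 1) := by nlinarith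
    have : (α + β + 2) * (n + 1) * (x + y) ≤ K * d := by
      have h1 := mul_le_mul_of_nonneg_right hl1 hx
      have h2 := mul_le_mul_of_nonneg_right hl2 hy
      refine le_trans ?_ hle
      rw [hxdef, hydef] at *
      linarith
    rw [show K / (α + β + 2) * (1 / ((n : ℝ) + 1)) * d = K * d / ((α + β + 2) * (n + 1)) by
      field_simp, le_div_iff₀ (by positivity)]
    linarith
  refine ⟨μ, hμ, ?_⟩
  rw [← tendsto_add_atTop_iff_nat 2]
  refine squeeze_zero (fun n => (hb n).1.le) (fun n => (hb n).2.trans (hbound n)) ?_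
  have := (tendsto_one_div_add_atTop_nhds_zero_nat (𝕜 := ℝ)).const_mul (K / (α + β + 2))
  rwa [mul_zero] at this

/-! ### Functionals given by integrable weights. -/

theorem integrableOn_mul_eval {w : ℝ → ℝ} (hw : IntegrableOn w (Set.Ioo (-1) 1)) (p : ℝ[X]) :
    IntegrableOn (fun x => w x * p.eval x) (Set.Ioo (-1) 1) :=
  hw.mul_continuousOn_of_subset p.continuous.continuousOn measurableSet_Ioo
    (isCompact_Icc (a := -1) (b := 1)) Set.Ioo_subset_Icc_self

/-- The linear functional `p ↦ ∫ p w` over `]-1,1[` given by an integrable weight `w`. -/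
noncomputable def weightFunctional (w : ℝ → ℝ) (hw : IntegrableOn w (Set.Ioo (-1) 1)) :
    ℝ[X] →ₗ[ℝ] ℝ where
  toFun p := ∫ x in Set.Ioo (-1 : ℝ) 1, w x * p.eval x
  map_add' p q := by
    rw [← integral_add (integrableOn_mul_eval hw p) (integrableOn_mul_eval hw q)]
    simp only [eval_add, mul_add]
  map_smul' a p := by
    rw [RingHom.id_apply, smul_eq_mul, ← integral_const_mul]
    simp only [eval_smul, smul_eq_mul, mul_left_comm]

theorem weightFunctional_apply {w : ℝ → ℝ} (hw : IntegrableOn w (Set.Ioo (-1) 1)) (p : ℝ[X]) :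
    weightFunctional w hw p = ∫ x in Set.Ioo (-1 : ℝ) 1, w x * p.eval x := rfl

theorem weightFunctional_sq_pos {w : ℝ → ℝ} (hw : IntegrableOn w (Set.Ioo (-1) 1))
    (hpos : ∀ x ∈ Set.Ioo (-1 : ℝ) 1, 0 < w x) {p : ℝ[X]} (hp : p ≠ 0) :
    0 < weightFunctional w hw (p ^ 2) := by
  rw [weightFunctional_apply, setIntegral_pos_iff_support_of_nonneg_ae
    (ae_restrict_of_forall_mem measurableSet_Ioo fun x hx => ?_) (integrableOn_mul_eval hw _)]
  · have h0 : volume (p.rootSet ℝ) = 0 := (rootSet_finite p ℝ).measure_zero _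
    have h1 : volume (Set.Ioo (-1 : ℝ) 1 \ p.rootSet ℝ) = volume (Set.Ioo (-1 : ℝ) 1) :=
      measure_sdiff_null h0
    refine lt_of_lt_of_le ?_ (measure_mono (s := Set.Ioo (-1 : ℝ) 1 \ p.rootSet ℝ) ?_)
    · rw [h1, Real.volume_Ioo]
      norm_num
    · rintro x ⟨hx, hxr⟩
      refine ⟨?_, hx⟩
      rw [Function.mem_support, eval_pow]
      refine mul_ne_zero (hpos x hx).ne' (pow_ne_zero _ fun h => hxr ?_)
      rw [mem_rootSet_of_ne hp, coe_aeval_eq_eval, h]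
  · simp only [Pi.zero_apply, eval_pow]
    exact mul_nonneg (hpos x hx).le (sq_nonneg _)

theorem integrable_eval_withDensity {w : ℝ → ℝ} (hw : IntegrableOn w (Set.Ioo (-1) 1))
    (hpos : ∀ x ∈ Set.Ioo (-1 : ℝ) 1, 0 < w x) (p : ℝ[X]) :
    Integrable (fun x => p.eval x)
      ((volume.restrict (Set.Ioo (-1 : ℝ) 1)).withDensity fun x => ENNReal.ofReal (w x)) := by
  rw [integrable_withDensity_iff_integrable_smul₀' hw.aestronglyMeasurable.aemeasurable.ennreal_ofReal
    (Eventually.of_forall fun x => ENNReal.ofReal_lt_top)]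
  refine (integrableOn_mul_eval hw p).congr
    (ae_restrict_of_forall_mem measurableSet_Ioo fun x hx => ?_)
  simp only [ENNReal.toReal_ofReal (hpos x hx).le, smul_eq_mul]

theorem functional_withDensity {w : ℝ → ℝ} (hw : IntegrableOn w (Set.Ioo (-1) 1))
    (hpos : ∀ x ∈ Set.Ioo (-1 : ℝ) 1, 0 < w x) (p : ℝ[X]) :
    functional ((volume.restrict (Set.Ioo (-1 : ℝ) 1)).withDensity fun x => ENNReal.ofReal (w x)) p
      = weightFunctional w hw p := by
  rw [functional, integral_withDensity_eq_integral_toReal_smul₀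
    hw.aestronglyMeasurable.aemeasurable.ennreal_ofReal
    (Eventually.of_forall fun x => ENNReal.ofReal_lt_top), weightFunctional_apply]
  refine setIntegral_congr_fun measurableSet_Ioo fun x hx => ?_
  simp only [ENNReal.toReal_ofReal (hpos x hx).le, smul_eq_mul]

/-! ### The Jacobi weight. -/

theorem rpow_le_one_add_two_rpow {t : ℝ} (γ : ℝ) (ht : 1 ≤ t) (ht2 : t ≤ 2) :
    t ^ γ ≤ 1 + 2 ^ γ := by
  have h2 : (0 : ℝ) < 2 ^ γ := by positivity
  rcases le_total 0 γ with h | h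
  · linarith [Real.rpow_le_rpow (by linarith) ht2 h]
  · linarith [Real.rpow_le_one_of_one_le_of_nonpos ht h]

theorem jacobiWeight_pos (α β : ℝ) {x : ℝ} (hx : x ∈ Set.Ioo (-1 : ℝ) 1) :
    0 < (1 - x) ^ α * (1 + x) ^ β :=
  mul_pos (Real.rpow_pos_of_pos (by linarith [hx.2]) _) (Real.rpow_pos_of_pos (by linarith [hx.1]) _)

theorem integrableOn_jacobiWeight {α β : ℝ} (hα : -1 < α) (hβ : -1 < β) :
    IntegrableOn (fun x : ℝ => (1 - x) ^ α * (1 + x) ^ β) (Set.Ioo (-1) 1) := by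
  have h1 : IntegrableOn (fun x : ℝ => (1 - x) ^ α) (Set.Ioo (-1) 1) := by
    have := (intervalIntegral.intervalIntegrable_rpow' hα (a := 2) (b := 0)).comp_sub_left 1
    norm_num at this
    rwa [intervalIntegrable_iff_integrableOn_Ioo_of_le (by norm_num)] at this
  have h2 : IntegrableOn (fun x : ℝ => (1 + x) ^ β) (Set.Ioo (-1) 1) := by
    have := (intervalIntegral.intervalIntegrable_rpow' hβ (a := 0) (b := 2)).comp_add_left 1
    norm_num at this
    rwa [intervalIntegrable_iff_integrableOn_Ioo_of_le (by norm_num)] at this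
  -- On each half of the interval one factor has its base in `[1, 2]`, hence is bounded whatever the
  -- sign of its exponent; the other carries the singularity.
  refine Integrable.mono' ((h1.const_mul (1 + 2 ^ β)).add (h2.const_mul (1 + 2 ^ α)))
    (by fun_prop) (ae_restrict_of_forall_mem measurableSet_Ioo fun x hx => ?_)
  rw [Real.norm_of_nonneg (jacobiWeight_pos α β hx).le]
  have ha : 0 < (1 - x) ^ α := Real.rpow_pos_of_pos (by linarith [hx.2]) _
  have hb : 0 < (1 + x) ^ β := Real.rpow_pos_of_pos (by linarith [hx.1]) _
  have ha2 : (0 : ℝ) < 2 ^ α := by positivity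
  have hb2 : (0 : ℝ) < 2 ^ β := by positivity
  simp only [Pi.add_apply]
  rcases le_total 0 x with h | h
  · have := rpow_le_one_add_two_rpow (t := 1 + x) β (by linarith) (by linarith [hx.2])
    nlinarith [mul_le_mul_of_nonneg_left this ha.le, mul_pos ha2 hb]
  · have := rpow_le_one_add_two_rpow (t := 1 - x) α (by linarith) (by linarith [hx.1])
    nlinarith [mul_le_mul_of_nonneg_right this hb.le, mul_pos hb2 ha]

theorem jacobiWeight_succ (α β : ℝ) {x : ℝ} (hx : x ∈ Set.Ioo (-1 : ℝ) 1) :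
    (1 - x) ^ (α + 1) * (1 + x) ^ (β + 1) = (1 - x ^ 2) * ((1 - x) ^ α * (1 + x) ^ β) := by
  rw [Real.rpow_add_one (by linarith [hx.2]), Real.rpow_add_one (by linarith [hx.1])]
  ring

theorem weightFunctional_jacobi_succ {α β : ℝ} (hα : -1 < α) (hβ : -1 < β) (p : ℝ[X]) :
    weightFunctional _ (integrableOn_jacobiWeight (α := α + 1) (β := β + 1)
        (by linarith) (by linarith)) p
      = weightFunctional _ (integrableOn_jacobiWeight hα hβ) ((1 - X ^ 2) * p) := by
  rw [weightFunctional_apply, weightFunctional_apply]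
  refine setIntegral_congr_fun measurableSet_Ioo fun x hx => ?_
  simp only [jacobiWeight_succ α β hx, eval_mul, eval_sub, eval_one, eval_pow, eval_X]
  ring

/-- The difference of the two sides integrates the derivative of `(1-x)^(α+1) (1+x)^(β+1) r`, whose
boundary values vanish since `α + 1` and `β + 1` are positive. -/
theorem weightFunctional_jacobi_derivative {α β : ℝ} (hα : -1 < α) (hβ : -1 < β) (r : ℝ[X]) :
    weightFunctional _ (integrableOn_jacobiWeight (α := α + 1) (β := β + 1)
        (by linarith) (by linarith)) (derivative r)
      = weightFunctional _ (integrableOn_jacobiWeight hα hβ)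
        ((C (α + 1) * (1 + X) - C (β + 1) * (1 - X)) * r) := by
  rw [← sub_eq_zero, weightFunctional_jacobi_succ hα hβ, ← map_sub, weightFunctional_apply]
  set g : ℝ[X] := (1 - X ^ 2) * derivative r - (C (α + 1) * (1 + X) - C (β + 1) * (1 - X)) * r
  have hint := integrableOn_mul_eval (integrableOn_jacobiWeight hα hβ) g
  have key := intervalIntegral.integral_eq_sub_of_hasDerivAt_of_le (a := -1) (b := 1) (by norm_num)
    (f := fun x : ℝ => (1 - x) ^ (α + 1) * (1 + x) ^ (β + 1) * r.eval x)
    (f' := fun x => (1 - x) ^ α * (1 + x) ^ β * g.eval x) ?_ ?_ ?_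
  · rw [intervalIntegral.integral_of_le (by norm_num), integral_Ioc_eq_integral_Ioo] at key
    rw [key]
    have h1 : α + 1 ≠ 0 := by linarith
    have h2 : β + 1 ≠ 0 := by linarith
    simp [Real.zero_rpow h1, Real.zero_rpow h2]
  · refine ContinuousOn.mul (ContinuousOn.mul ?_ ?_) r.continuous.continuousOn
    · exact (ContinuousOn.rpow_const (by fun_prop) fun x _ => Or.inr (by linarith))
    · exact (ContinuousOn.rpow_const (by fun_prop) fun x _ => Or.inr (by linarith))
  · intro x hx
    have hx1 : (1 - x) ≠ 0 := by linarith [hx.2]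
    have hx2 : (1 + x) ≠ 0 := by linarith [hx.1]
    have d1 : HasDerivAt (fun x : ℝ => (1 - x) ^ (α + 1)) (-(α + 1) * (1 - x) ^ α) x := by
      have := ((hasDerivAt_id x).const_sub 1).rpow_const (p := α + 1) (Or.inl hx1)
      simpa using this
    have d2 : HasDerivAt (fun x : ℝ => (1 + x) ^ (β + 1)) ((β + 1) * (1 + x) ^ β) x := by
      have := ((hasDerivAt_id x).const_add 1).rpow_const (p := β + 1) (Or.inl hx2)
      simpa using this
    refine ((d1.mul d2).mul (r.hasDerivAt x)).congr_deriv ?_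
    simp only [Pi.mul_apply, g, eval_sub, eval_mul, eval_add, eval_C, eval_one, eval_X, eval_pow]
    rw [Real.rpow_add_one hx1, Real.rpow_add_one hx2]
    ring
  · rwa [intervalIntegrable_iff_integrableOn_Ioo_of_le (by norm_num)]

/-! ### The companion functional. -/

/-- The weight of the absolutely continuous part of the companion measure. -/
noncomputable def companionWeight (α β ξ x : ℝ) : ℝ :=
  1 / |x - ξ| * ((1 - x) ^ (α + 1) * (1 + x) ^ (β + 1))

theorem one_sub_le_abs_sub_or {ξ : ℝ} (hξ : 1 ≤ |ξ|) :
    (1 ≤ ξ ∧ ∀ x ∈ Set.Ioo (-1 : ℝ) 1, |x - ξ| = -1 * (x - ξ)) ∨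
      (ξ ≤ -1 ∧ ∀ x ∈ Set.Ioo (-1 : ℝ) 1, |x - ξ| = 1 * (x - ξ)) := by
  rcases le_abs.1 hξ with h | h
  · refine Or.inl ⟨h, fun x hx => ?_⟩
    rw [abs_of_neg (by linarith [hx.2]), neg_one_mul]
  · refine Or.inr ⟨by linarith, fun x hx => ?_⟩
    rw [abs_of_pos (by linarith [hx.1]), one_mul]

theorem abs_sub_pos {ξ : ℝ} (hξ : 1 ≤ |ξ|) {x : ℝ} (hx : x ∈ Set.Ioo (-1 : ℝ) 1) :
    0 < |x - ξ| := by
  refine abs_pos.2 (sub_ne_zero.2 ?_)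
  rintro rfl
  exact hξ.not_gt (abs_lt.2 hx)

theorem companionWeight_pos (α β : ℝ) {ξ : ℝ} (hξ : 1 ≤ |ξ|) {x : ℝ}
    (hx : x ∈ Set.Ioo (-1 : ℝ) 1) : 0 < companionWeight α β ξ x :=
  mul_pos (one_div_pos.2 (abs_sub_pos hξ hx)) (jacobiWeight_pos _ _ hx)

theorem abs_sub_mul_companionWeight (α β : ℝ) {ξ : ℝ} (hξ : 1 ≤ |ξ|) {x : ℝ}
    (hx : x ∈ Set.Ioo (-1 : ℝ) 1) :
    |x - ξ| * companionWeight α β ξ x = (1 - x) ^ (α + 1) * (1 + x) ^ (β + 1) := by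
  have := (abs_sub_pos hξ hx).ne'
  rw [companionWeight]
  field_simp

/-- As `|ξ| ≥ 1`, `|x - ξ|` is at least the distance from `x` to the endpoint on the side of `ξ`;
the extra power there absorbs the pole, even for `|ξ| = 1`. -/
theorem integrableOn_companionWeight {α β ξ : ℝ} (hα : -1 < α) (hβ : -1 < β) (hξ : 1 ≤ |ξ|) :
    IntegrableOn (companionWeight α β ξ) (Set.Ioo (-1) 1) := by
  have hmeas : AEStronglyMeasurable (companionWeight α β ξ)
      (volume.restrict (Set.Ioo (-1 : ℝ) 1)) := by
    unfold companionWeight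
    fun_prop
  rcases one_sub_le_abs_sub_or hξ with ⟨h, h'⟩ | ⟨h, h'⟩
  · refine Integrable.mono' (integrableOn_jacobiWeight (β := β + 1) hα (by linarith)) hmeas
      (ae_restrict_of_forall_mem measurableSet_Ioo fun x hx => ?_)
    rw [Real.norm_of_nonneg (companionWeight_pos α β hξ hx).le, companionWeight, h' x hx,
      Real.rpow_add_one (by linarith [hx.2]), one_div, inv_mul_le_iff₀ (by linarith [hx.2])]
    have := (jacobiWeight_pos α (β + 1) hx).le
    nlinarith [mul_nonneg (sub_nonneg.2 h) this]
  · refine Integrable.mono' (integrableOn_jacobiWeight (α := α + 1) (by linarith) hβ) hmeas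
      (ae_restrict_of_forall_mem measurableSet_Ioo fun x hx => ?_)
    rw [Real.norm_of_nonneg (companionWeight_pos α β hξ hx).le, companionWeight, h' x hx,
      Real.rpow_add_one (y := β) (by linarith [hx.1]), one_div,
      inv_mul_le_iff₀ (by linarith [hx.1])]
    have := (jacobiWeight_pos (α + 1) β hx).le
    nlinarith [mul_nonneg (sub_nonneg.2 h) this]

/-- The functional of the companion measure, as a linear map. -/
noncomputable def companionFunctional {α β ξ : ℝ} (hα : -1 < α) (hβ : -1 < β) (hξ : 1 ≤ |ξ|)
    (M : ℝ) : ℝ[X] →ₗ[ℝ] ℝ :=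
  weightFunctional _ (integrableOn_companionWeight hα hβ hξ) + M • leval ξ

section

variable {α β ξ M : ℝ} (hα : -1 < α) (hβ : -1 < β) (hξ : 1 ≤ |ξ|)

theorem companionFunctional_apply (p : ℝ[X]) :
    companionFunctional hα hβ hξ M p
      = weightFunctional _ (integrableOn_companionWeight hα hβ hξ) p + M * p.eval ξ := rfl

theorem functional_companionMeasure (hM : 0 ≤ M) :
    functional (companionMeasure α β ξ M) = companionFunctional hα hβ hξ M := by
  ext p
  have hw := integrableOn_companionWeight hα hβ hξ
  have hpos := fun x hx => companionWeight_pos α β hξ (x := x) hx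
  have hcm : companionMeasure α β ξ M = (volume.restrict (Set.Ioo (-1 : ℝ) 1)).withDensity
      (fun x => ENNReal.ofReal (companionWeight α β ξ x)) + ENNReal.ofReal M • Measure.dirac ξ := rfl
  rw [companionFunctional_apply, ← functional_withDensity hw hpos, functional, hcm,
    integral_add_measure (integrable_eval_withDensity hw hpos p)
      ((integrable_dirac (by simp)).smul_measure ENNReal.ofReal_ne_top),
    integral_smul_measure, integral_dirac, ENNReal.toReal_ofReal hM, smul_eq_mul]
  rfl

theorem companionFunctional_sq_pos (hM : 0 ≤ M) {p : ℝ[X]} (hp : p ≠ 0) :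
    0 < companionFunctional hα hβ hξ M (p ^ 2) := by
  rw [companionFunctional_apply, eval_pow]
  exact add_pos_of_pos_of_nonneg
    (weightFunctional_sq_pos _ (fun x hx => companionWeight_pos α β hξ hx) hp)
    (mul_nonneg hM (sq_nonneg _))

/-- The factor `X - C ξ` kills the point mass, and `s = ±1` is the constant sign of `x - ξ` on
`]-1,1[`. -/
theorem exists_weightFunctional_jacobi_eq : ∃ s : ℝ, s ≠ 0 ∧ ∀ p : ℝ[X],
    weightFunctional _ (integrableOn_jacobiWeight (α := α + 1) (β := β + 1)
      (by linarith) (by linarith)) p = s * companionFunctional hα hβ hξ M ((X - C ξ) * p) := by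
  obtain ⟨s, hs, h⟩ : ∃ s : ℝ, s ≠ 0 ∧ ∀ x ∈ Set.Ioo (-1 : ℝ) 1, |x - ξ| = s * (x - ξ) := by
    rcases one_sub_le_abs_sub_or hξ with h | h
    · exact ⟨-1, by norm_num, h.2⟩
    · exact ⟨1, by norm_num, h.2⟩
  refine ⟨s, hs, fun p => ?_⟩
  rw [companionFunctional_apply, weightFunctional_apply, weightFunctional_apply]
  simp only [eval_mul, eval_sub, eval_X, eval_C, sub_self, zero_mul, mul_zero, add_zero]
  rw [← integral_const_mul]
  refine setIntegral_congr_fun measurableSet_Ioo fun x hx => ?_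
  simp only [← abs_sub_mul_companionWeight α β hξ hx, h x hx]
  ring

/-- The constant bounds `|x - ξ|` on `]-1,1[`; the point mass only enlarges the right side. -/
theorem weightFunctional_jacobi_sq_le (hM : 0 ≤ M) (p : ℝ[X]) :
    weightFunctional _ (integrableOn_jacobiWeight (α := α + 1) (β := β + 1)
      (by linarith) (by linarith)) (p ^ 2)
      ≤ (1 + |ξ|) * companionFunctional hα hβ hξ M (p ^ 2) := by
  have hw := integrableOn_companionWeight hα hβ hξ
  rw [companionFunctional_apply, mul_add]
  refine le_add_of_le_of_nonneg ?_ ?_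
  · rw [weightFunctional_apply, weightFunctional_apply, ← integral_const_mul]
    refine setIntegral_mono_on (integrableOn_mul_eval (integrableOn_jacobiWeight (by linarith)
      (by linarith)) _) ((integrableOn_mul_eval hw _).const_mul _) measurableSet_Ioo fun x hx => ?_
    rw [← abs_sub_mul_companionWeight α β hξ hx, mul_assoc]
    refine mul_le_mul_of_nonneg_right ?_
      (mul_nonneg (companionWeight_pos α β hξ hx).le (by rw [eval_pow]; positivity))
    exact (abs_sub x ξ).trans (by gcongr; exact (abs_lt.2 hx).le)
  · rw [eval_pow]
    positivity

end

end CoherentPair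

theorem mainTheorem11 (α β ξ M : ℝ) (hα : -1 < α) (hβ : -1 < β) (hξ : 1 ≤ |ξ|) (hM : 0 ≤ M) :
    (∃ (P T : ℕ → ℝ[X]) (σ : ℕ → ℝ),
      CoherentPair.IsCoherent
        (CoherentPair.functional (CoherentPair.jacobiMeasure α β))
        (CoherentPair.functional (CoherentPair.companionMeasure α β ξ M)) P T σ) ∧
    ∀ (P T : ℕ → ℝ[X]) (σ : ℕ → ℝ),
      CoherentPair.IsCoherent
        (CoherentPair.functional (CoherentPair.jacobiMeasure α β))
        (CoherentPair.functional (CoherentPair.companionMeasure α β ξ M)) P T σ →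
      ∃ μ : ℕ → ℝ,
        (∀ n : ℕ, 1 ≤ n →
          IsLeast {x : ℝ | (CoherentPair.recPoly
            (CoherentPair.functional (CoherentPair.jacobiMeasure α β))
            (CoherentPair.functional (CoherentPair.companionMeasure α β ξ M))
            P T σ n).IsRoot x} (μ n)) ∧
        Tendsto μ atTop (𝓝 0) := by
  open CoherentPair in
  have hw₀ := integrableOn_jacobiWeight hα hβ
  have hJ : functional (jacobiMeasure α β) = weightFunctional _ hw₀ :=
    funext fun p => functional_withDensity hw₀ (fun x hx => jacobiWeight_pos α β hx) p
  rw [hJ, functional_companionMeasure hα hβ hξ hM]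
  have hc₀ : ∀ p, p ≠ 0 → 0 < weightFunctional _ hw₀ (p ^ 2) := fun p hp =>
    weightFunctional_sq_pos hw₀ (fun x hx => jacobiWeight_pos α β hx) hp
  have hc₁ : ∀ p, p ≠ 0 → 0 < companionFunctional hα hβ hξ M (p ^ 2) := fun p hp =>
    companionFunctional_sq_pos hα hβ hξ hM hp
  constructor
  · obtain ⟨s, hs, h⟩ := exists_weightFunctional_jacobi_eq (M := M) hα hβ hξ
    exact exists_isCoherent (weightFunctional_jacobi_succ hα hβ)
      (weightFunctional_jacobi_derivative hα hβ) hs h hc₀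
      (fun p hp => weightFunctional_sq_pos _ (fun x hx => jacobiWeight_pos _ _ hx) hp) hc₁
  · intro P T σ h
    exact exists_tendsto_isLeast_isRoot_recPoly hα hβ (weightFunctional_jacobi_succ hα hβ)
      (weightFunctional_jacobi_derivative hα hβ)
      (weightFunctional_jacobi_sq_le hα hβ hξ hM) hc₀ hc₁ h
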